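/- Let $F$ be Thompson's group $F$: the group, under composition, of all increasing piecewise linear homeomorphisms of $[0,1]$ with finitely many breakpoints, all of them dyadic rationals, and with all slopes integer powers of $2$. Let $X=\mathrm{Orb}(1/2)\subset[0,1]$ be the orbit of $1/2$ under $F$. For a probability measure $\mu$ on $F$ put $P_\mu(x,y)=\sum_{g\in F}\mathbf 1_{\{g\cdot x=y\}}\,\mu(g)$ for $x,y\in X$. The action of $F$ on $X$ is called $\mu$-Liouville if every bounded function $f:X\to\mathbb R$ with $f(x)=\sum_{y\in X}f(y)P_\mu(x,y)$ for all $x\in X$ is constant. Theorem. There is a probability measure $\mu$ on $F$, with infinite support, that is non-degenerate ($\operatorname{supp}\mu$ generates $F$ as a group) and symmetric ($\mu(g^{-1})=\mu(g)$ for all $g\in F$), such that the action of $F$ on $X$ is $\mu$-Liouville. -/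

import Mathlib

/-- A real number is a dyadic rational if it has the form `m / 2 ^ n`. -/
def IsDyadic (x : ℝ) : Prop :=
  ∃ (m : ℤ) (n : ℕ), x = (m : ℝ) / 2 ^ n

theorem IsDyadic.add {x y : ℝ} (hx : IsDyadic x) (hy : IsDyadic y) : IsDyadic (x + y) := by
  obtain ⟨a, m, rfl⟩ := hx
  obtain ⟨b, n, rfl⟩ := hy
  refine ⟨a * 2 ^ n + b * 2 ^ m, m + n, ?_⟩
  push_cast
  field_simp
  ring

theorem IsDyadic.neg {x : ℝ} (hx : IsDyadic x) : IsDyadic (-x) := by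
  obtain ⟨a, m, rfl⟩ := hx
  exact ⟨-a, m, by push_cast; ring⟩

theorem IsDyadic.zpow_mul {x : ℝ} (hx : IsDyadic x) (k : ℤ) : IsDyadic ((2 : ℝ) ^ k * x) := by
  obtain ⟨a, m, rfl⟩ := hx
  obtain ⟨n, rfl | rfl⟩ := k.eq_nat_or_neg
  · refine ⟨2 ^ n * a, m, ?_⟩
    push_cast
    rw [zpow_natCast]
    ring
  · refine ⟨a, m + n, ?_⟩
    rw [zpow_neg, zpow_natCast, pow_add]
    field_simp

/-- An increasing bijection `f` of `[0, 1]` is dyadic piecewise linear if there is a finite set `B`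
of dyadic rationals (containing the breakpoints of `f`) such that on every closed interval without
points of `B` in its interior, `f` is affine with slope an integer power of `2`. -/
def IsDyadicPL (f : unitInterval ≃o unitInterval) : Prop :=
  ∃ B : Finset unitInterval, (∀ p ∈ B, IsDyadic (p : ℝ)) ∧
    ∀ a b : unitInterval, a < b → (∀ p ∈ B, p ∉ Set.Ioo a b) →
      ∃ (k : ℤ) (c : ℝ), ∀ x ∈ Set.Icc a b, (f x : ℝ) = (2 : ℝ) ^ k * (x : ℝ) + c

theorem IsDyadicPL.map_isDyadic {f : unitInterval ≃o unitInterval} (hf : IsDyadicPL f)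
    (x : unitInterval) (hx : IsDyadic (x : ℝ)) : IsDyadic (f x : ℝ) := by
  obtain ⟨B, hB, h⟩ := hf
  have h0 : f 0 = 0 := f.map_bot
  have key : ∀ (n : ℕ) (x : unitInterval), (B.filter (· < x)).card = n → IsDyadic (x : ℝ) →
      IsDyadic (f x : ℝ) := by
    intro n
    induction n using Nat.strong_induction_on with
    | _ n ih =>
      intro x hn hx
      -- it suffices to find a smaller dyadic point with dyadic value and no breakpoint in between
      have step : ∀ p : unitInterval, p < x → IsDyadic (p : ℝ) → IsDyadic (f p : ℝ) →
          (∀ q ∈ B, q ∉ Set.Ioo p x) → IsDyadic (f x : ℝ) := by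
        intro p hpx hp hfp hq
        obtain ⟨k, c, hk⟩ := h p x hpx hq
        have e : (f x : ℝ) = f p + 2 ^ k * ((x : ℝ) + -(p : ℝ)) := by
          rw [hk x ⟨hpx.le, le_rfl⟩, hk p ⟨le_rfl, hpx.le⟩]
          ring
        rw [e]
        exact hfp.add ((hx.add hp.neg).zpow_mul k)
      by_cases hne : (B.filter (· < x)).Nonempty
      · obtain ⟨p, hp, hmax⟩ := (B.filter (· < x)).exists_max_image id hne
        obtain ⟨hpB, hpx⟩ := Finset.mem_filter.1 hp
        refine step p hpx (hB p hpB) (ih _ ?_ p rfl (hB p hpB)) ?_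
        · rw [← hn]
          refine Finset.card_lt_card ((Finset.ssubset_iff_of_subset ?_).2 ⟨p, hp, by simp⟩)
          intro q hq
          obtain ⟨hqB, hqp⟩ := Finset.mem_filter.1 hq
          exact Finset.mem_filter.2 ⟨hqB, hqp.trans hpx⟩
        · intro q hqB hq
          exact absurd (hmax q (Finset.mem_filter.2 ⟨hqB, hq.2⟩)) (not_le.2 hq.1)
      · have hz : IsDyadic ((0 : unitInterval) : ℝ) := ⟨0, 0, by simp⟩
        rcases (unitInterval.nonneg' : 0 ≤ x).eq_or_lt with rfl | hx0
        · rw [h0]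
          exact hz
        · refine step 0 hx0 hz (by rw [h0]; exact hz) ?_
          intro q hqB hq
          exact hne ⟨q, Finset.mem_filter.2 ⟨hqB, hq.2⟩⟩
  exact key _ x rfl hx

theorem IsDyadicPL.one : IsDyadicPL 1 :=
  ⟨∅, by simp, fun _ _ _ _ => ⟨0, 0, fun x _ => by simp⟩⟩

theorem IsDyadicPL.inv {f : unitInterval ≃o unitInterval} (hf : IsDyadicPL f) :
    IsDyadicPL f⁻¹ := by
  classical
  have hd := hf.map_isDyadic
  obtain ⟨B, hB, h⟩ := hf
  refine ⟨B.image f, ?_, ?_⟩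
  · intro p hp
    obtain ⟨q, hq, rfl⟩ := Finset.mem_image.1 hp
    exact hd q (hB q hq)
  · intro a b hab hp
    obtain ⟨k, c, hk⟩ := h (f.symm a) (f.symm b) (f.symm.strictMono hab) (by
      intro p hpB hpI
      refine hp (f p) (Finset.mem_image_of_mem f hpB) ⟨?_, ?_⟩
      · exact f.symm_apply_lt.1 hpI.1 
      · exact f.lt_symm_apply.1 hpI.2)
    refine ⟨-k, -((2 : ℝ) ^ (-k) * c), fun x hx => ?_⟩
    have e := hk (f.symm x) ⟨f.symm.monotone hx.1, f.symm.monotone hx.2⟩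
    rw [f.apply_symm_apply] at e
    change ((f.symm x : unitInterval) : ℝ) = _
    rw [e, zpow_neg]
    field_simp
    ring

theorem IsDyadicPL.mul {f g : unitInterval ≃o unitInterval} (hf : IsDyadicPL f)
    (hg : IsDyadicPL g) : IsDyadicPL (f * g) := by
  classical
  have hd := hg.inv.map_isDyadic
  obtain ⟨B, hB, h⟩ := hf
  obtain ⟨C, hC, h'⟩ := hg
  refine ⟨C ∪ B.image g.symm, ?_, ?_⟩
  · intro p hp
    rcases Finset.mem_union.1 hp with hp | hp
    · exact hC p hp
    · obtain ⟨q, hq, rfl⟩ := Finset.mem_image.1 hp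
      exact hd q (hB q hq)
  · intro a b hab hp
    obtain ⟨k, c, hk⟩ := h' a b hab fun p hpC => hp p (Finset.mem_union_left _ hpC)
    obtain ⟨l, d, hl⟩ := h (g a) (g b) (g.strictMono hab) (by
      intro p hpB hpI
      refine hp (g.symm p) (Finset.mem_union_right _ (Finset.mem_image_of_mem _ hpB)) ⟨?_, ?_⟩
      · exact g.lt_symm_apply.2 hpI.1
      · exact g.symm_apply_lt.2 hpI.2)
    refine ⟨l + k, (2 : ℝ) ^ l * c + d, fun x hx => ?_⟩
    change ((f (g x) : unitInterval) : ℝ) = _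
    rw [hl (g x) ⟨g.monotone hx.1, g.monotone hx.2⟩, hk x hx, zpow_add₀ two_ne_zero]
    ring

/-- Thompson's group `F`: the group, under composition, of all increasing piecewise linear
bijections of `[0, 1]` whose finitely many breakpoints are dyadic rationals and whose slopes are
integer powers of `2`. -/
def ThompsonF : Subgroup (unitInterval ≃o unitInterval) where
  carrier := {f | IsDyadicPL f}
  mul_mem' := IsDyadicPL.mul
  one_mem' := IsDyadicPL.one
  inv_mem' := IsDyadicPL.inv

/-- The action of `F` on `[0, 1]` (Mathlib's action of order automorphisms) is by evaluation. -/
theorem ThompsonF.smul_def (g : ThompsonF) (x : unitInterval) :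
    g • x = (g : unitInterval ≃o unitInterval) x :=
  rfl

/-- The point `1 / 2` of `[0, 1]`. -/
noncomputable def unitHalf : unitInterval :=
  ⟨1 / 2, by norm_num, by norm_num⟩

/-- A probability measure on a discrete group is non-degenerate if its support generates the
group. -/
def NonDegenerate {G : Type*} [Group G] (μ : PMF G) : Prop :=
  Subgroup.closure μ.support = ⊤

/-- A probability measure on a discrete group is symmetric if it is invariant under inversion. -/
def SymmetricPMF {G : Type*} [Group G] (μ : PMF G) : Prop :=
  ∀ g : G, μ g⁻¹ = μ g

open Classical in
/-- The transition matrix `P_μ(x, y) = ∑_g 1_{g x = y} μ(g)` on a `G`-set `X`. -/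
noncomputable def transitionMatrix {G X : Type*} [Group G] [MulAction G X] (μ : PMF G)
    (x y : X) : ℝ :=
  ∑' g : G, if g • x = y then (μ g).toReal else 0

/-- A bounded function `f` is `P_μ`-harmonic if `f(x) = ∑_y f(y) P_μ(x, y)` for all `x` (the sum
converges absolutely because `f` is bounded). -/
def IsBoundedHarmonic {G X : Type*} [Group G] [MulAction G X] (μ : PMF G) (f : X → ℝ) : Prop :=
  (∃ C : ℝ, ∀ x, |f x| ≤ C) ∧ ∀ x, f x = ∑' y : X, f y * transitionMatrix μ x y

/-- The action of `G` on `X` is `μ`-Liouville if all bounded `P_μ`-harmonic functions are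
constant. -/
def IsLiouvilleAction {G : Type*} (X : Type*) [Group G] [MulAction G X] (μ : PMF G) : Prop :=
  ∀ f : X → ℝ, IsBoundedHarmonic μ f → ∀ x y : X, f x = f y

/-! The action of `F` on the orbit can merge points: given a finite set `E` of orbit points, choose
`n` so large that all have denominator `2 ^ n`. An element `h` of `F` translates by `2 ^ (-n)` along
the level-`n` grid inside `(0, 1)`, so any two points of `E` differ by a bounded power of `h`. The
uniform measure on a long interval of powers of `h` then sends them to distributions close in total
variation, and adding `g` and `g⁻¹` with small weight keeps it symmetric and puts any prescribed `g`
in the support.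

Such measures are mixed as `μ = ∑ c k • ν k`. Each `ν k` is chosen after its predecessors and
merges, up to `1 / (k + 1)`, every point reachable from `x₀` in `n k` steps using their supports.
Two walks driven by the same indices use the same increments while the index is below `k`; at the
first index `≥ k` they are merged. Since `c` has full support, an index `≥ k` appears within `n k`
steps except with small probability, so a bounded harmonic function takes nearly equal values at the
two starting points (`abs_sub_le_of_merges`); then `k → ∞`. As `F` is countable, `ν k` can contain
the `k`-th element, so `μ` has full support, which gives non-degeneracy and, `F` being infinite,
infinite support. -/

open scoped ENNReal Pointwise

/-! ### Expectations under discrete probability measures -/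

namespace PMF

variable {α β : Type*}

/-- The expectation of a real function with respect to a discrete probability measure. -/
noncomputable def expect (p : PMF α) (φ : α → ℝ) : ℝ :=
  ∑' a, (p a).toReal * φ a

theorem hasSum_toReal (p : PMF α) : HasSum (fun a => (p a).toReal) 1 := by
  have h : Summable fun a => (p a).toReal := ENNReal.summable_toReal (by simp [p.tsum_coe])
  have e : ∑' a, (p a).toReal = 1 := by
    rw [← ENNReal.tsum_toReal_eq p.apply_ne_top, p.tsum_coe, ENNReal.toReal_one]
  exact e ▸ h.hasSum

theorem summable_expect (p : PMF α) {φ : α → ℝ} {C : ℝ} (hφ : ∀ a, |φ a| ≤ C) :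
    Summable fun a => (p a).toReal * φ a := by
  refine Summable.of_norm_bounded (p.hasSum_toReal.summable.mul_right C) fun a => ?_
  rw [Real.norm_eq_abs, abs_mul, abs_of_nonneg ENNReal.toReal_nonneg]
  exact mul_le_mul_of_nonneg_left (hφ a) ENNReal.toReal_nonneg

theorem expect_sub (p : PMF α) {φ ψ : α → ℝ} {C D : ℝ} (hφ : ∀ a, |φ a| ≤ C)
    (hψ : ∀ a, |ψ a| ≤ D) : p.expect (fun a => φ a - ψ a) = p.expect φ - p.expect ψ := by
  simp only [expect, mul_sub]
  exact (p.summable_expect hφ).tsum_sub (p.summable_expect hψ)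

theorem abs_expect_le_of_hasSum (p : PMF α) {φ ψ : α → ℝ} {s : ℝ}
    (h : ∀ a ∈ p.support, |φ a| ≤ ψ a) (hs : HasSum (fun a => (p a).toReal * ψ a) s) :
    |p.expect φ| ≤ s := by
  rw [← Real.norm_eq_abs]
  refine tsum_of_norm_bounded hs fun a => ?_
  rw [Real.norm_eq_abs, abs_mul, abs_of_nonneg ENNReal.toReal_nonneg]
  by_cases ha : a ∈ p.support
  · exact mul_le_mul_of_nonneg_left (h a ha) ENNReal.toReal_nonneg
  · simp [(p.apply_eq_zero_iff a).2 ha]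

theorem abs_expect_le (p : PMF α) {φ : α → ℝ} {C : ℝ} (h : ∀ a ∈ p.support, |φ a| ≤ C) :
    |p.expect φ| ≤ C :=
  p.abs_expect_le_of_hasSum h (by simpa using p.hasSum_toReal.mul_right C)

theorem expect_bind (p : PMF α) (q : α → PMF β) {φ : β → ℝ} {C : ℝ} (hφ : ∀ b, |φ b| ≤ C) :
    (p.bind q).expect φ = p.expect fun a => (q a).expect φ := by
  have hs : Summable (Function.uncurry fun b a => (p a * q a b).toReal) := by
    refine ENNReal.summable_toReal (f := fun x : β × α => p x.2 * q x.2 x.1) ?_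
    rw [ENNReal.tsum_prod (f := fun b a => p a * q a b), ENNReal.tsum_comm]
    simp [ENNReal.tsum_mul_left, PMF.tsum_coe]
  have hs' : Summable (Function.uncurry fun b a => (p a * q a b).toReal * φ b) := by
    refine Summable.of_norm_bounded (hs.mul_right C) fun x => ?_
    rw [Function.uncurry, Function.uncurry, Real.norm_eq_abs, abs_mul,
      abs_of_nonneg ENNReal.toReal_nonneg]
    exact mul_le_mul_of_nonneg_left (hφ _) ENNReal.toReal_nonneg
  calc (p.bind q).expect φ = ∑' b, ∑' a, (p a * q a b).toReal * φ b := by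
        refine tsum_congr fun b => ?_
        rw [PMF.bind_apply, ENNReal.tsum_toReal_eq fun a =>
          ENNReal.mul_ne_top (p.apply_ne_top a) ((q a).apply_ne_top b), tsum_mul_right]
    _ = ∑' a, ∑' b, (p a * q a b).toReal * φ b := hs'.tsum_comm.symm
    _ = _ := by
        refine tsum_congr fun a => ?_
        simp only [expect, ENNReal.toReal_mul, mul_assoc, tsum_mul_left]

theorem expect_pure (a : α) (φ : α → ℝ) : (PMF.pure a).expect φ = φ a := by
  classical
  rw [expect, tsum_eq_single a fun b hb => by simp [PMF.pure_apply, hb]]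
  simp

theorem expect_map (p : PMF α) (m : α → β) {φ : β → ℝ} {C : ℝ} (hφ : ∀ b, |φ b| ≤ C) :
    (p.map m).expect φ = p.expect (φ ∘ m) := by
  rw [← PMF.bind_pure_comp, p.expect_bind _ hφ]
  simp [expect_pure, Function.comp_def]

theorem expect_uniformOfFintype [Fintype α] [Nonempty α] (φ : α → ℝ) :
    (PMF.uniformOfFintype α).expect φ = (Fintype.card α : ℝ)⁻¹ * ∑ a, φ a := by
  simp [expect, tsum_fintype, Finset.mul_sum]

theorem exists_support_eq_univ_nat : ∃ c : PMF ℕ, ∀ n, c n ≠ 0 := by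
  have h : ∑' n : ℕ, (2⁻¹ : ℝ≥0∞) ^ n = 2 := by
    rw [ENNReal.tsum_geometric, ENNReal.one_sub_inv_two, inv_inv]
  refine ⟨PMF.normalize (fun n : ℕ => (2⁻¹ : ℝ≥0∞) ^ n) (by rw [h]; simp) (by rw [h]; simp), ?_⟩
  intro n
  rw [PMF.normalize_apply, h]
  simp

end PMF

/-! ### From merging finite sets to the Liouville property -/

section Liouville

variable {G X : Type*} [Group G] [MulAction G X]

/-- The sum over `G` is regrouped along the fibres of `g ↦ g • x`; boundedness of `f` gives absolute
convergence. -/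
theorem tsum_mul_transitionMatrix (μ : PMF G) {f : X → ℝ} {C : ℝ} (hf : ∀ x, |f x| ≤ C) (x : X) :
    ∑' y, f y * transitionMatrix μ x y = μ.expect fun g => f (g • x) := by
  have hs : Summable fun g : G => (μ g).toReal * f (g • x) := μ.summable_expect fun g => hf _
  have hs' := (Equiv.sigmaFiberEquiv fun g : G => g • x).summable_iff.2 hs
  rw [PMF.expect, ← (Equiv.sigmaFiberEquiv fun g : G => g • x).tsum_eq]
  refine Eq.trans (tsum_congr fun y => ?_) hs'.tsum_sigma.symm
  rw [transitionMatrix, ← tsum_mul_left]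
  have := tsum_subtype {g : G | g • x = y} fun g => (μ g).toReal * f (g • x)
  refine Eq.trans (tsum_congr fun g => ?_) this.symm
  by_cases hg : g • x = y
  · simp [Set.indicator, hg, mul_comm]
  · simp [Set.indicator, hg]

theorem IsBoundedHarmonic.eq_expect {μ : PMF G} {f : X → ℝ} (h : IsBoundedHarmonic μ f) (x : X) :
    f x = μ.expect fun g => f (g • x) := by
  obtain ⟨⟨C, hC⟩, hf⟩ := h
  rw [hf x, tsum_mul_transitionMatrix μ hC]

/-- A probability measure on `G` merges a finite set `E` up to `ε` if the images of any two Dirac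
masses at points of `E` are `ε`-close in total variation. -/
def Merges (ν : PMF G) (E : Finset X) (ε : ℝ) : Prop :=
  ∀ x ∈ E, ∀ y ∈ E, ∀ (f : X → ℝ) (C : ℝ), (∀ z, |f z| ≤ C) →
    |ν.expect (fun g => f (g • x)) - ν.expect (fun g => f (g • y))| ≤ ε * C

theorem Merges.mono {ν : PMF G} {E E' : Finset X} {ε ε' : ℝ} (h : Merges ν E ε) (hE : E' ⊆ E)
    (hε : ε ≤ ε') : Merges ν E' ε' := fun x hx y hy f C hf =>
  (h x (hE hx) y (hE hy) f C hf).trans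
    (mul_le_mul_of_nonneg_right hε ((abs_nonneg _).trans (hf x)))

/-- If the measures `ν i`, `i ≥ k`, merge the points reachable in `N` steps with `S`, which supports
all `ν i`, `i < k`, then a bounded harmonic function of the mixture is almost constant on the
starting points. -/
theorem abs_sub_le_of_merges [DecidableEq G] [DecidableEq X] {c : PMF ℕ}
    {ν : ℕ → PMF G} {f : X → ℝ} {C ε : ℝ} (hC : ∀ x, |f x| ≤ C)
    (hf : ∀ x, f x = (c.bind ν).expect fun g => f (g • x))
    {S : Finset G} {x₀ : X} {k N : ℕ} (hS : ∀ i < k, (ν i).support ⊆ S)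
    (hm : ∀ i, k ≤ i → Merges (ν i) ((S ^ N).image (· • x₀)) ε) (h1 : 1 ∈ S) (n : ℕ) :
    ∀ m, m + n ≤ N → ∀ g ∈ S ^ m, ∀ g' ∈ S ^ m, |f (g • x₀) - f (g' • x₀)| ≤
      ε * C + 2 * C * (∑ i ∈ Finset.range k, (c i).toReal) ^ n := by
  have hfS : ∀ x, f x = c.expect fun i => (ν i).expect fun g => f (g • x) := fun x => by
    rw [hf x, PMF.expect_bind _ _ fun g => hC _]
  have hb : ∀ x i, |(ν i).expect fun g => f (g • x)| ≤ C := fun x i =>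
    (ν i).abs_expect_le fun g _ => hC _
  -- No sign of `ε` is assumed; merging `x₀` with itself supplies it.
  have h0 : 0 ≤ ε * C := by
    have := hm k le_rfl x₀ ?_ x₀ ?_ f C hC
    · exact (abs_nonneg _).trans this
    all_goals
      refine Finset.mem_image.2 ⟨1, ?_, one_smul _ _⟩
      exact Finset.pow_subset_pow_right h1 (Nat.zero_le N) (by simp)
  induction n with
  | zero =>
    intro m _ g _ g' _
    have := abs_sub (f (g • x₀)) (f (g' • x₀))
    have := hC (g • x₀)
    have := hC (g' • x₀)
    rw [pow_zero]
    linarith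
  | succ n ih =>
    intro m hmn g hg g' hg'
    set s := ∑ i ∈ Finset.range k, (c i).toReal with hs
    rw [hfS (g • x₀), hfS (g' • x₀), ← c.expect_sub (hb _) (hb _)]
    -- The bound for each first index `i`: the merging error always, plus the remaining failure term
    -- `2 * C * s ^ n` only if `i < k`. Averaging over `i` produces the extra factor `s`.
    have hsum : HasSum (fun i => (c i).toReal *
        (ε * C + if i ∈ Finset.range k then 2 * C * s ^ n else 0))
        (ε * C + 2 * C * s ^ (n + 1)) := by
      have h1 := c.hasSum_toReal.mul_right (ε * C)
      have h2 : HasSum (fun i => (c i).toReal *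
          if i ∈ Finset.range k then 2 * C * s ^ n else 0) (2 * C * s ^ (n + 1)) := by
        have e : 2 * C * s ^ (n + 1) = ∑ i ∈ Finset.range k, (c i).toReal *
            if i ∈ Finset.range k then 2 * C * s ^ n else 0 := by
          rw [Finset.sum_congr rfl fun i hi => by rw [if_pos hi], ← Finset.sum_mul]
          ring
        rw [e]
        exact hasSum_sum_of_ne_finset_zero fun i hi => by rw [if_neg hi, mul_zero]
      simpa only [mul_add, one_mul] using h1.add h2
    refine c.abs_expect_le_of_hasSum (fun i _ => ?_) hsum
    -- For `i < k` the same increment moves both points, from `S ^ m` to `S ^ (m + 1)`, and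
    -- induction applies. For `i ≥ k` both points still lie in the set that `ν i` merges.
    by_cases hi : i < k
    · rw [if_pos (Finset.mem_range.2 hi), ← (ν i).expect_sub (fun _ => hC _) fun _ => hC _]
      refine (ν i).abs_expect_le fun a ha => ?_
      rw [← mul_smul, ← mul_smul]
      refine ih (m + 1) (by omega) _ ?_ _ ?_
      all_goals
        rw [pow_succ']
        exact Finset.mul_mem_mul (hS i hi ha) (by assumption)
    · rw [if_neg (by simpa using hi), add_zero]
      refine hm i (not_lt.1 hi) _ ?_ _ ?_ f C hC
      all_goals
        refine Finset.mem_image_of_mem _ (Finset.pow_subset_pow_right h1 (by omega : m ≤ N) ?_)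
        assumption

theorem PMF.sum_range_lt_one {c : PMF ℕ} (hc : ∀ n, c n ≠ 0) (k : ℕ) :
    ∑ i ∈ Finset.range k, (c i).toReal < 1 := by
  have h := c.hasSum_toReal
  have h1 := h.summable.sum_le_tsum (Finset.range (k + 1)) fun _ _ => ENNReal.toReal_nonneg
  rw [h.tsum_eq, Finset.sum_range_succ] at h1
  have := ENNReal.toReal_pos (hc k) (c.apply_ne_top k)
  linarith

/-- A transitive action of a countable group has a symmetric Liouville measure of full support if
every finite set is merged up to any `ε` by finitely supported symmetric measures. -/
theorem exists_liouville_of_merges [Countable G] [MulAction.IsPretransitive G X]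
    (H : ∀ (E : Finset X) (ε : ℝ), 0 < ε → ∀ g : G, ∃ ν : PMF G, ν.support.Finite ∧
      SymmetricPMF ν ∧ g ∈ ν.support ∧ Merges ν E ε) :
    ∃ μ : PMF G, SymmetricPMF μ ∧ μ.support = Set.univ ∧ IsLiouvilleAction X μ := by
  classical
  obtain ⟨c, hc⟩ := PMF.exists_support_eq_univ_nat
  obtain ⟨e, he⟩ := exists_surjective_nat G
  rcases isEmpty_or_nonempty X with hX | ⟨⟨x₀⟩⟩
  · choose ν h1 h2 h3 h4 using H ∅ 1 one_pos
    refine ⟨c.bind fun k => ν (e k), fun g => ?_, ?_, fun f _ x => isEmptyElim x⟩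
    · simp only [PMF.bind_apply, h2 _ g]
    · refine Set.eq_univ_of_forall fun g => ?_
      obtain ⟨k, rfl⟩ := he g
      exact (PMF.mem_support_bind_iff _ _ _).2 ⟨k, hc k, h3 _⟩
  choose n₀ hn₀ using fun k : ℕ =>
    exists_pow_lt_of_lt_one (Nat.one_div_pos_of_nat (α := ℝ) (n := k)) (PMF.sum_range_lt_one hc k)
  -- Partial sums make `n` monotone, so for `i ≥ k` the set merged by `ν i` contains the one needed
  -- at stage `k`. The `+ 1` is for the starting points, which lie in `S k ^ 1` rather than `S k ^
  -- 0`.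
  let n : ℕ → ℕ := fun k => ∑ i ∈ Finset.range (k + 1), n₀ i + 1
  have hn : Monotone n := fun a b hab =>
    Nat.succ_le_succ (Finset.sum_le_sum_of_subset (Finset.range_subset_range.2 (by omega)))
  have hnn : ∀ k, n₀ k + 1 ≤ n k := fun k => Nat.succ_le_succ <|
    Finset.single_le_sum (f := n₀) (fun _ _ => Nat.zero_le _) (Finset.self_mem_range_succ k)
  choose ν hfin hsym hmem hmer using fun (k : ℕ) (S : Finset G) =>
    H ((S ^ n k).image (· • x₀)) (1 / ((k : ℝ) + 1)) Nat.one_div_pos_of_nat (e k)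
  obtain ⟨S, hS0, hS⟩ : ∃ S : ℕ → Finset G, S 0 = {1} ∧
      ∀ k, S (k + 1) = S k ∪ (hfin k (S k)).toFinset :=
    ⟨fun k => Nat.rec {1} (fun k S => S ∪ (hfin k S).toFinset) k, rfl, fun _ => rfl⟩
  have hmono : Monotone S := monotone_nat_of_le_succ fun k => by
    rw [hS]
    exact Finset.subset_union_left
  have h1 : ∀ k, 1 ∈ S k := fun k => hmono (Nat.zero_le k) (by simp [hS0])
  have hsupp : ∀ i k : ℕ, i < k → (ν i (S i)).support ⊆ (S k : Set G) := by
    intro i k hik g hg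
    refine hmono (Nat.succ_le_of_lt hik) ?_
    rw [hS]
    exact Finset.mem_union_right _ ((hfin i (S i)).mem_toFinset.2 hg)
  refine ⟨c.bind fun k => ν k (S k), fun g => ?_, ?_, fun f hf => ?_⟩
  · simp only [PMF.bind_apply, hsym _ _ g]
  · refine Set.eq_univ_of_forall fun g => ?_
    obtain ⟨k, rfl⟩ := he g
    exact (PMF.mem_support_bind_iff _ _ _).2 ⟨k, hc k, hmem _ _⟩
  · obtain ⟨C, hC⟩ := hf.1
    have key : ∀ x, f x = f x₀ := by
      intro x
      obtain ⟨g, rfl⟩ := MulAction.exists_smul_eq G x₀ x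
      obtain ⟨j, rfl⟩ := he g
      have hC0 : 0 ≤ C := (abs_nonneg _).trans (hC x₀)
      -- The constant is `1` from the merging error plus `2` from the failure term. The condition `j
      -- < k` ensures `e j ∈ S k`.
      have hj : ∀ k, j < k → |f (e j • x₀) - f x₀| ≤ 3 * C * (1 / ((k : ℝ) + 1)) := by
        intro k hk
        have h := abs_sub_le_of_merges hC hf.eq_expect (S := S k) (x₀ := x₀) (k := k) (N := n k)
          (fun i hi => hsupp i k hi) (fun i hi => (hmer i (S i)).mono (ε' := 1 / ((k : ℝ) + 1))
            (Finset.image_subset_image ((Finset.pow_subset_pow_left (hmono hi)).trans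
              (Finset.pow_subset_pow_right (h1 i) (hn hi)))) (Nat.one_div_le_one_div hi))
          (h1 k) (n₀ k) 1 (by have := hnn k; omega) (e j)
          (by simpa using hsupp j k hk (hmem _ _)) 1 (by simpa using h1 k)
        rw [one_smul] at h
        have := mul_le_mul_of_nonneg_left (hn₀ k).le (mul_nonneg zero_le_two hC0)
        linarith
      have ht : Filter.Tendsto (fun k : ℕ => 3 * C * (1 / ((k : ℝ) + 1))) Filter.atTop
          (nhds 0) := by
        simpa using tendsto_one_div_add_atTop_nhds_zero_nat.const_mul (3 * C)
      have := ge_of_tendsto ht ((Filter.eventually_gt_atTop j).mono hj)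
      exact sub_eq_zero.1 (abs_eq_zero.1 (this.antisymm (abs_nonneg _)))
    exact fun x y => (key x).trans (key y).symm

end Liouville

/-! ### Merging along powers of one element -/

section Merging

variable {G X : Type*} [Group G] [MulAction G X]

/-- The powers `h ^ i` and `h ^ (-i)`, `i < N`, together with `g` and `g⁻¹`. -/
def symmetricPowers (h g : G) (N : ℕ) : Bool × Option (Fin N) → G
  | (true, some i) => h ^ (i : ℕ)
  | (false, some i) => (h ^ (i : ℕ))⁻¹
  | (true, none) => g
  | (false, none) => g⁻¹

/-- The uniform measure on the powers `h ^ i`, `|i| < N`, perturbed by `g` and `g⁻¹`. -/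
noncomputable def powerMeasure (h g : G) (N : ℕ) : PMF G :=
  (PMF.uniformOfFintype (Bool × Option (Fin N))).map (symmetricPowers h g N)

theorem PMF.map_equiv_uniformOfFintype {ι : Type*} [Fintype ι] [Nonempty ι] (σ : ι ≃ ι) :
    (PMF.uniformOfFintype ι).map σ = PMF.uniformOfFintype ι := by
  classical
  ext i
  rw [PMF.map_apply, tsum_eq_single (σ.symm i) fun j hj => if_neg fun h => hj (by simp [h])]
  simp

theorem PMF.map_inv_apply (p : PMF G) (g : G) : p.map (·⁻¹) g = p g⁻¹ := by
  classical
  rw [PMF.map_apply, tsum_eq_single g⁻¹ fun j hj => if_neg fun h => hj (by simp [h])]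
  simp

theorem symmetricPMF_powerMeasure (h g : G) (N : ℕ) : SymmetricPMF (powerMeasure h g N) := by
  intro x
  rw [← PMF.map_inv_apply, powerMeasure, PMF.map_comp]
  conv_rhs => rw [← PMF.map_equiv_uniformOfFintype (Equiv.boolNot.prodCongr (Equiv.refl _)),
    PMF.map_comp]
  congr 2
  funext ⟨b, i⟩
  rcases b with _ | _ <;> rcases i with _ | i <;> simp [symmetricPowers]

theorem finite_support_powerMeasure (h g : G) (N : ℕ) : (powerMeasure h g N).support.Finite := by
  rw [powerMeasure, PMF.support_map]
  exact (Set.toFinite _).image _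

theorem mem_support_powerMeasure (h g : G) (N : ℕ) : g ∈ (powerMeasure h g N).support :=
  (PMF.mem_support_map_iff _ _ _).2 ⟨(true, none), by simp, rfl⟩

/-- Replacing `x` by `h • x` telescopes both the positive and the negative powers, leaving one
difference of size at most `2 * C` each; `g` and `g⁻¹` contribute two more. The total `8 * C` is
divided by the `2 * (N + 1)` atoms, counted with multiplicity. -/
theorem abs_expect_powerMeasure_sub_le (h g : G) (N : ℕ) {f : X → ℝ} {C : ℝ}
    (hf : ∀ x, |f x| ≤ C) (x : X) :
    |(powerMeasure h g N).expect (fun a => f (a • h • x)) -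
      (powerMeasure h g N).expect (fun a => f (a • x))| ≤ 4 / ((N : ℝ) + 1) * C := by
  have hN : (0 : ℝ) < (N : ℝ) + 1 := by positivity
  have hd : ∀ y z, |f y - f z| ≤ 2 * C := fun y z => by
    have := abs_sub (f y) (f z)
    have := hf y
    have := hf z
    linarith
  have hpos : |∑ i : Fin N, (f (h ^ (i : ℕ) • h • x) - f (h ^ (i : ℕ) • x))| ≤ 2 * C := by
    rw [Fin.sum_univ_eq_sum_range fun i => f (h ^ i • h • x) - f (h ^ i • x)]
    have := Finset.sum_range_sub (fun i => f (h ^ i • x)) N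
    simp only [pow_succ, mul_smul] at this
    rw [this]
    exact hd _ _
  have hneg : |∑ i : Fin N, (f ((h ^ (i : ℕ))⁻¹ • h • x) - f ((h ^ (i : ℕ))⁻¹ • x))| ≤ 2 * C := by
    rw [Fin.sum_univ_eq_sum_range fun i => f ((h ^ i)⁻¹ • h • x) - f ((h ^ i)⁻¹ • x)]
    have := Finset.sum_range_sub' (fun i => f ((h ^ i)⁻¹ • h • x)) N
    simp only [pow_succ', mul_inv_rev, mul_smul, inv_smul_smul] at this
    rw [this]
    exact hd _ _
  have e : ∀ y, (powerMeasure h g N).expect (fun a => f (a • y)) = (2 * ((N : ℝ) + 1))⁻¹ *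
      (f (g • y) + ∑ i : Fin N, f (h ^ (i : ℕ) • y) +
        (f (g⁻¹ • y) + ∑ i : Fin N, f ((h ^ (i : ℕ))⁻¹ • y))) := fun y => by
    rw [powerMeasure, PMF.expect_map _ _ fun _ => hf _, PMF.expect_uniformOfFintype]
    simp [Fintype.sum_prod_type, symmetricPowers]
  rw [Finset.sum_sub_distrib] at hpos hneg
  rw [e, e, ← mul_sub, abs_mul, abs_of_pos (by positivity), inv_mul_le_iff₀ (by positivity)]
  have hg := hd (g • h • x) (g • x)
  have hg' := hd (g⁻¹ • h • x) (g⁻¹ • x)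
  have : 2 * ((N : ℝ) + 1) * (4 / ((N : ℝ) + 1) * C) = 8 * C := by
    field_simp
    ring
  rw [this]
  rw [abs_le] at *
  constructor <;> linarith

/-- If any two points of `E` differ by a bounded power of `h`, long intervals of powers of `h`
merge `E`. -/
theorem exists_merges_of_pow {E : Finset X} {h : G} {K : ℕ}
    (hE : ∀ x ∈ E, ∀ y ∈ E, ∃ j ≤ K, h ^ j • x = y ∨ h ^ j • y = x) {ε : ℝ} (hε : 0 < ε) (g : G) :
    ∃ ν : PMF G, ν.support.Finite ∧ SymmetricPMF ν ∧ g ∈ ν.support ∧ Merges ν E ε := by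
  obtain ⟨N, hN⟩ := exists_nat_gt ((K : ℝ) * 4 / ε)
  refine ⟨powerMeasure h g N, finite_support_powerMeasure h g N, symmetricPMF_powerMeasure h g N,
    mem_support_powerMeasure h g N, fun x hx y hy f C hf => ?_⟩
  have hC : 0 ≤ C := (abs_nonneg _).trans (hf x)
  have hN1 : (0 : ℝ) < (N : ℝ) + 1 := by positivity
  have key : ∀ (j : ℕ) (z : X), |(powerMeasure h g N).expect (fun a => f (a • h ^ j • z)) -
      (powerMeasure h g N).expect (fun a => f (a • z))| ≤ j * (4 / ((N : ℝ) + 1) * C) := by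
    intro j z
    induction j with
    | zero => simp
    | succ j ih =>
      have := abs_expect_powerMeasure_sub_le h g N hf (h ^ j • z)
      rw [pow_succ', mul_smul]
      refine (abs_sub_le _ _ _).trans ((add_le_add this ih).trans_eq ?_)
      push_cast
      ring
  have hK : ∀ j ≤ K, (j : ℝ) * (4 / ((N : ℝ) + 1) * C) ≤ ε * C := by
    intro j hj
    have hj' : (j : ℝ) ≤ K := Nat.cast_le.2 hj
    rw [← mul_assoc]
    refine mul_le_mul_of_nonneg_right ?_ hC
    rw [mul_div_assoc', div_le_iff₀ hN1]
    rw [div_lt_iff₀ hε] at hN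
    nlinarith
  obtain ⟨j, hj, rfl | rfl⟩ := hE x hx y hy
  · rw [abs_sub_comm]
    exact (key j x).trans (hK j hj)
  · exact (key j y).trans (hK j hj)

end Merging

/-! ### Countability of `F` -/

theorem unitInterval.orderIso_map_zero (f : unitInterval ≃o unitInterval) : f 0 = 0 := f.map_bot

theorem unitInterval.orderIso_map_one (f : unitInterval ≃o unitInterval) : f 1 = 1 := f.map_top

/-- Two increasing bijections that are affine off a common finite set `B` and agree on `B` are
equal. -/
theorem OrderIso.eq_of_affine_off {B : Finset unitInterval} {f g : unitInterval ≃o unitInterval}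
    (hf : ∀ a b : unitInterval, a < b → (∀ p ∈ B, p ∉ Set.Ioo a b) →
      ∃ k c : ℝ, ∀ x ∈ Set.Icc a b, (f x : ℝ) = k * (x : ℝ) + c)
    (hg : ∀ a b : unitInterval, a < b → (∀ p ∈ B, p ∉ Set.Ioo a b) →
      ∃ k c : ℝ, ∀ x ∈ Set.Icc a b, (g x : ℝ) = k * (x : ℝ) + c)
    (hfg : ∀ p ∈ B, f p = g p) : f = g := by
  classical
  -- With the fixed endpoints added, every other point has neighbours in the set on both sides, and
  -- two affine maps agreeing at both neighbours coincide between them.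
  let B' : Finset unitInterval := insert 0 (insert 1 B)
  have hB' : ∀ p ∈ B', f p = g p := by
    intro p hp
    simp only [B', Finset.mem_insert] at hp
    rcases hp with rfl | rfl | hp
    · rw [unitInterval.orderIso_map_zero, unitInterval.orderIso_map_zero]
    · rw [unitInterval.orderIso_map_one, unitInterval.orderIso_map_one]
    · exact hfg p hp
  ext x
  by_cases hx : x ∈ B'
  · rw [hB' x hx]
  have hx0 : 0 < x := lt_of_le_of_ne unitInterval.nonneg' fun h => hx (by simp [B', ← h])
  have hx1 : x < 1 := lt_of_le_of_ne unitInterval.le_one' fun h => hx (by simp [B', h])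
  obtain ⟨a, ha, hamax⟩ := (B'.filter (· < x)).exists_max_image id
    ⟨0, Finset.mem_filter.2 ⟨by simp [B'], hx0⟩⟩
  obtain ⟨b, hb, hbmin⟩ := (B'.filter (x < ·)).exists_min_image id
    ⟨1, Finset.mem_filter.2 ⟨by simp [B'], hx1⟩⟩
  obtain ⟨haB, hax⟩ := Finset.mem_filter.1 ha
  obtain ⟨hbB, hxb⟩ := Finset.mem_filter.1 hb
  have hoff : ∀ p ∈ B, p ∉ Set.Ioo a b := by
    intro p hp ⟨h1, h2⟩
    have hpB : p ∈ B' := by simp [B', hp]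
    rcases lt_trichotomy p x with h | rfl | h
    · exact absurd (hamax p (Finset.mem_filter.2 ⟨hpB, h⟩)) (not_le.2 h1)
    · exact hx hpB
    · exact absurd (hbmin p (Finset.mem_filter.2 ⟨hpB, h⟩)) (not_le.2 h2)
  have hab := hax.trans hxb
  obtain ⟨k, c, hk⟩ := hf a b hab hoff
  obtain ⟨l, d, hl⟩ := hg a b hab hoff
  have ea : k * (a : ℝ) + c = l * a + d := by
    rw [← hk a ⟨le_rfl, hab.le⟩, ← hl a ⟨le_rfl, hab.le⟩, hB' a haB]
  have eb : k * (b : ℝ) + c = l * b + d := by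
    rw [← hk b ⟨hab.le, le_rfl⟩, ← hl b ⟨hab.le, le_rfl⟩, hB' b hbB]
  have hab' : (a : ℝ) < b := hab
  have hkl : k = l := by
    have : (k - l) * ((b : ℝ) - a) = 0 := by linarith
    rcases mul_eq_zero.1 this with h | h <;> linarith
  subst hkl
  rw [hk x ⟨hax.le, hxb.le⟩, hl x ⟨hax.le, hxb.le⟩]
  linarith

/-- An element is determined by its graph over a chosen breakpoint set, and this graph is a finite
subset of a countable set because dyadics map to dyadics. -/
instance ThompsonF.instCountable : Countable ThompsonF := by
  classical
  let D := {x : unitInterval // IsDyadic (x : ℝ)}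
  have hD : Countable D := by
    choose m n h using fun x : D => x.2
    refine Function.Injective.countable (f := fun x : D => (m x, n x)) fun x y hxy => ?_
    obtain ⟨h1, h2⟩ := Prod.mk.inj hxy
    exact Subtype.ext (Subtype.ext (by rw [h x, h y, h1, h2]))
  choose B hB hBf using fun f : ThompsonF => f.2
  let code : ThompsonF → Finset (unitInterval × unitInterval) := fun f =>
    (B f).image fun p => (p, (f : unitInterval ≃o unitInterval) p)
  have hcode : ∀ f, ∀ q ∈ code f, q ∈ Set.range fun d : D × D => (d.1.1, d.2.1) := by
    intro f q hq
    obtain ⟨p, hp, rfl⟩ := Finset.mem_image.1 hq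
    exact ⟨(⟨p, hB f p hp⟩, ⟨_, IsDyadicPL.map_isDyadic f.2 p (hB f p hp)⟩), rfl⟩
  have hc := Set.countable_ofPred_finite_subset
    (Set.countable_range fun d : D × D => (d.1.1, d.2.1))
  have := hc.to_subtype
  let code' : ThompsonF → {t : Set (unitInterval × unitInterval) |
      t.Finite ∧ t ⊆ Set.range fun d : D × D => (d.1.1, d.2.1)} := fun f =>
    ⟨code f, (code f).finite_toSet, fun q hq => hcode f q hq⟩
  refine Function.Injective.countable (f := code') fun f g hfg => ?_
  have hfg' : code f = code g := Finset.coe_injective (congrArg Subtype.val hfg)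
  have hBB : B f = B g := by
    have := congrArg (Finset.image Prod.fst) hfg'
    simpa [code, Finset.image_image, Function.comp_def] using this
  refine Subtype.ext (OrderIso.eq_of_affine_off (B := B f) (fun a b hab h => ?_)
    (fun a b hab h => ?_) fun p hp => ?_)
  · obtain ⟨k, c, hk⟩ := hBf f a b hab h
    exact ⟨_, c, hk⟩
  · obtain ⟨k, c, hk⟩ := hBf g a b hab (hBB ▸ h)
    exact ⟨_, c, hk⟩
  · have : (p, (f : unitInterval ≃o unitInterval) p) ∈ code g :=
      hfg' ▸ Finset.mem_image_of_mem _ hp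
    obtain ⟨q, _, hq⟩ := Finset.mem_image.1 this
    obtain ⟨rfl, h2⟩ := Prod.mk.inj hq
    exact h2.symm

/-! ### Shifts of dyadic grids and the orbit of `1 / 2` -/

/-- The increasing bijection of `[0, 1]` that is the translation by `δ` on `[δ, 1 - 2 δ]`, and is
affine with slope `2` before and slope `1 / 2` after that interval. -/
noncomputable def dyadicShift (δ : ℝ) (h0 : 0 < δ) (h1 : δ ≤ 1 / 4) :
    unitInterval ≃o unitInterval :=
  StrictMono.orderIsoOfRightInverse
    -- A minimum of increasing lines; its inverse is the maximum of the inverse lines.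
    (fun x => ⟨min (min (2 * x) (x + δ)) ((x + 1) / 2), by
      have := x.2.1
      exact le_min (le_min (by linarith) (by linarith)) (by linarith), by
      have := x.2.2
      exact (min_le_right _ _).trans (by linarith)⟩)
    (by
      intro x y hxy
      have hxy' : (x : ℝ) < y := hxy
      exact Subtype.mk_lt_mk.2 (min_lt_min (min_lt_min (by linarith) (by linarith)) (by linarith)))
    (fun y => ⟨max (max (y / 2) (y - δ)) (2 * y - 1), by
      have := y.2.1
      exact (le_max_left _ _).trans' ((le_max_left _ _).trans' (by linarith)), by
      have := y.2.2
      exact max_le (max_le (by linarith) (by linarith)) (by linarith)⟩)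
    (by
      intro y
      apply Subtype.ext
      have := y.2.1
      have := y.2.2
      rcases max_cases (max ((y : ℝ) / 2) (y - δ)) (2 * y - 1) with ⟨h, h'⟩ | ⟨h, h'⟩ <;>
      rcases max_cases ((y : ℝ) / 2) (y - δ) with ⟨h2, h2'⟩ | ⟨h2, h2'⟩ <;>
      simp only [h2] at * <;>
      simp only [min_def] <;> split_ifs <;> linarith)

theorem coe_dyadicShift (δ : ℝ) (h0 : 0 < δ) (h1 : δ ≤ 1 / 4) (x : unitInterval) :
    (dyadicShift δ h0 h1 x : ℝ) =
      min (min (2 * (x : ℝ)) (x + δ)) (((x : ℝ) + 1) / 2) :=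
  rfl

theorem isDyadicPL_dyadicShift {δ : ℝ} (h0 : 0 < δ) (h1 : δ ≤ 1 / 4) (hδ : IsDyadic δ) :
    IsDyadicPL (dyadicShift δ h0 h1) := by
  classical
  -- The breakpoints are where consecutive lines cross: `2 * x = x + δ` at `δ`, and `x + δ = (x + 1)
  -- / 2` at `1 - 2 * δ`.
  refine ⟨{⟨δ, h0.le, by linarith⟩, ⟨1 - 2 * δ, by linarith, by linarith⟩}, ?_, ?_⟩
  · intro p hp
    rcases Finset.mem_insert.1 hp with rfl | hp
    · exact hδ
    · rw [Finset.mem_singleton.1 hp]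
      have h := (hδ.zpow_mul 1).neg
      have : IsDyadic (1 : ℝ) := ⟨1, 0, by simp⟩
      simpa [sub_eq_add_neg] using this.add h
  · intro a b hab hp
    have hab' : (a : ℝ) < b := hab
    have e1 := hp ⟨δ, h0.le, by linarith⟩ (by simp)
    have e2 := hp ⟨1 - 2 * δ, by linarith, by linarith⟩ (by simp)
    simp only [Set.mem_Ioo, ← Subtype.coe_lt_coe, not_and, not_lt] at e1 e2
    by_cases ha : (a : ℝ) < δ
    · refine ⟨1, 0, fun x hx => ?_⟩
      have hx1 : (x : ℝ) ≤ b := hx.2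
      have := e1 ha
      rw [coe_dyadicShift, min_eq_left, min_eq_left] <;> norm_num
      · linarith
      · exact .inl (by linarith)
    by_cases ha' : (a : ℝ) < 1 - 2 * δ
    · refine ⟨0, δ, fun x hx => ?_⟩
      have hx1 : (x : ℝ) ≤ b := hx.2
      have hx0 : (a : ℝ) ≤ x := hx.1
      have := e2 ha'
      rw [coe_dyadicShift, min_eq_right (a := 2 * (x : ℝ)) (by linarith),
        min_eq_left (by linarith)]
      simp
    · refine ⟨-1, 1 / 2, fun x hx => ?_⟩
      have hx0 : (a : ℝ) ≤ x := hx.1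
      rw [coe_dyadicShift, min_eq_right (a := 2 * (x : ℝ)) (by linarith),
        min_eq_right (by linarith)]
      norm_num
      ring

theorem exists_pow_two_shift {n : ℕ} (hn : 2 ≤ n) : 
    ∃ h : ThompsonF, ∀ (x : unitInterval) (m j : ℕ), 1 ≤ m → m + j < 2 ^ n →
      (x : ℝ) = m / 2 ^ n → ((h ^ j • x : unitInterval) : ℝ) = (m + j) / 2 ^ n := by
  have h0 : (0 : ℝ) < 1 / 2 ^ n := by positivity
  have h1 : (1 : ℝ) / 2 ^ n ≤ 1 / 4 := by
    refine one_div_le_one_div_of_le (by norm_num) ?_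
    calc (4 : ℝ) = 2 ^ 2 := by norm_num
      _ ≤ 2 ^ n := pow_le_pow_right₀ (by norm_num) hn
  refine ⟨⟨dyadicShift _ h0 h1, isDyadicPL_dyadicShift h0 h1 ⟨1, n, by simp⟩⟩, ?_⟩
  intro x m j hm hmj hx
  induction j with
  | zero => simpa using hx
  | succ j ih =>
    have ih := ih (by omega)
    rw [pow_succ', mul_smul, ThompsonF.smul_def]
    rw [coe_dyadicShift, ih]
    have hm' : (1 : ℝ) ≤ m := by exact_mod_cast hm
    -- This says that the current point is at most `1 - 2 * δ` with `δ = 1 / 2 ^ n`, so the next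
    -- step is still a translation.
    have hmj' : (m : ℝ) + j + 2 ≤ 2 ^ n := by exact_mod_cast hmj
    have hj : (0 : ℝ) ≤ j := Nat.cast_nonneg j
    rw [min_eq_right (a := 2 * (((m : ℝ) + j) / 2 ^ n)), min_eq_left]
    · push_cast
      field_simp
      ring
    · rw [← sub_nonneg]
      have : (((m : ℝ) + j) / 2 ^ n + 1) / 2 - (((m : ℝ) + j) / 2 ^ n + 1 / 2 ^ n) =
        (2 ^ n - (m + j + 2)) / (2 * 2 ^ n) := by
        field_simp
        ring
      rw [this]
      exact div_nonneg (by linarith) (by positivity)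
    · rw [← sub_nonneg]
      have : 2 * (((m : ℝ) + j) / 2 ^ n) - (((m : ℝ) + j) / 2 ^ n + 1 / 2 ^ n) =
        (m + j - 1) / 2 ^ n := by
        field_simp
        ring
      rw [this]
      exact div_nonneg (by linarith) (by positivity)

/-- Elements of `F` preserve dyadics and fix `0` and `1`. Allowing every larger `n` lets a finite
set of points share a denominator. -/
theorem exists_nat_div_of_mem_orbit {x : unitInterval}
    (hx : x ∈ MulAction.orbit ThompsonF unitHalf) :
    ∃ k : ℕ, ∀ n, k ≤ n → ∃ m : ℕ, 1 ≤ m ∧ m < 2 ^ n ∧ (x : ℝ) = m / 2 ^ n := by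
  obtain ⟨g, rfl⟩ := hx
  have hd : IsDyadic ((g • unitHalf : unitInterval) : ℝ) :=
    IsDyadicPL.map_isDyadic g.2 unitHalf ⟨1, 1, by simp [unitHalf]⟩
  have h0 : (0 : ℝ) < (g • unitHalf : unitInterval) := by
    have h : (g : unitInterval ≃o unitInterval) 0 < (g : unitInterval ≃o unitInterval) unitHalf :=
      (g : unitInterval ≃o unitInterval).strictMono (Subtype.mk_lt_mk.2 (by norm_num))
    rw [unitInterval.orderIso_map_zero] at h
    exact h
  have h1 : ((g • unitHalf : unitInterval) : ℝ) < 1 := by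
    have h : (g : unitInterval ≃o unitInterval) unitHalf < (g : unitInterval ≃o unitInterval) 1 :=
      (g : unitInterval ≃o unitInterval).strictMono (Subtype.mk_lt_mk.2 (by norm_num))
    rw [unitInterval.orderIso_map_one] at h
    exact h
  change ∃ k : ℕ, ∀ n, k ≤ n → ∃ m : ℕ, 1 ≤ m ∧ m < 2 ^ n ∧
    ((g • unitHalf : unitInterval) : ℝ) = m / 2 ^ n
  obtain ⟨m, k, hmk⟩ := hd
  refine ⟨k, fun n hkn => ?_⟩
  rw [hmk] at h0 h1 ⊢
  have hk : (0 : ℝ) < 2 ^ k := by positivity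
  rw [div_lt_one hk] at h1
  have hm0 : 0 < m := by
    rw [div_pos_iff_of_pos_right hk] at h0
    exact_mod_cast h0
  lift m to ℕ using hm0.le
  have hm1 : m < 2 ^ k := by exact_mod_cast h1
  obtain ⟨d, rfl⟩ := Nat.exists_eq_add_of_le hkn
  refine ⟨m * 2 ^ d, ?_, ?_, ?_⟩
  · exact Nat.mul_pos (by omega) (by positivity)
  · rw [pow_add]
    exact Nat.mul_lt_mul_of_pos_right hm1 (by positivity)
  · push_cast
    rw [pow_add]
    field_simp

/-- Shifts by distinct powers of `1 / 2` take distinct values at `1 / 2`. -/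
instance ThompsonF.instInfinite : Infinite ThompsonF := by
  have h0 : ∀ n : ℕ, (0 : ℝ) < (1 / 2) ^ (n + 2) := fun n => by positivity
  have h1 : ∀ n : ℕ, (1 / 2 : ℝ) ^ (n + 2) ≤ 1 / 4 := fun n => by
    have : (1 / 2 : ℝ) ^ n ≤ 1 := pow_le_one₀ (by norm_num) (by norm_num)
    rw [pow_add]
    linarith
  have hval : ∀ n, (dyadicShift _ (h0 n) (h1 n) unitHalf : ℝ) = 1 / 2 + (1 / 2) ^ (n + 2) := by
    intro n
    have := h1 n
    rw [coe_dyadicShift, show (unitHalf : ℝ) = 1 / 2 from rfl,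
      min_eq_right (a := 2 * (1 / 2 : ℝ)) (by linarith), min_eq_left (by linarith)]
  refine Infinite.of_injective (fun n => (⟨dyadicShift _ (h0 n) (h1 n),
    isDyadicPL_dyadicShift _ _ ⟨1, n + 2, by simp⟩⟩ : ThompsonF)) fun n m hnm => ?_
  have h := congrArg (fun g : ThompsonF => ((g : unitInterval ≃o unitInterval) unitHalf : ℝ)) hnm
  simp only [hval, add_right_inj] at h
  have := pow_right_injective₀ (a := (1 / 2 : ℝ)) (by norm_num) (by norm_num) h
  omega

theorem ThompsonF.exists_pow_smul_eq (E : Finset (MulAction.orbit ThompsonF unitHalf)) :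
    ∃ (h : ThompsonF) (K : ℕ), ∀ x ∈ E, ∀ y ∈ E, ∃ j ≤ K, h ^ j • x = y ∨ h ^ j • y = x := by
  choose k hk using fun x : MulAction.orbit ThompsonF unitHalf => exists_nat_div_of_mem_orbit x.2
  let n := E.sup k + 2
  obtain ⟨h, hh⟩ := exists_pow_two_shift (n := n) (by omega)
  have main : ∀ (x y : MulAction.orbit ThompsonF unitHalf) (m m' : ℕ), 1 ≤ m → m' < 2 ^ n →
      m ≤ m' → ((x : unitInterval) : ℝ) = m / 2 ^ n → ((y : unitInterval) : ℝ) = m' / 2 ^ n →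
      h ^ (m' - m) • x = y := by
    intro x y m m' h1 h2 hm hx hy
    refine Subtype.ext (Subtype.ext ?_)
    have := hh x m (m' - m) h1 (by omega) hx
    rw [MulAction.orbit.coe_smul, this, hy, Nat.cast_sub hm]
    ring
  refine ⟨h, 2 ^ n, fun x hx y hy => ?_⟩
  obtain ⟨m, hm1, hm2, hm⟩ := hk x n ((Finset.le_sup hx).trans (by omega))
  obtain ⟨m', hm1', hm2', hm'⟩ := hk y n ((Finset.le_sup hy).trans (by omega))
  rcases le_total m m' with hle | hle
  · exact ⟨m' - m, by omega, .inl (main x y m m' hm1 hm2' hle hm hm')⟩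
  · exact ⟨m - m', by omega, .inr (main y x m' m hm1' hm2 hle hm' hm)⟩

theorem mainTheorem2 :
    ∃ μ : PMF ThompsonF, NonDegenerate μ ∧ SymmetricPMF μ ∧ μ.support.Infinite ∧
      IsLiouvilleAction (MulAction.orbit ThompsonF unitHalf) μ := by
  obtain ⟨μ, hsym, hsupp, hL⟩ := exists_liouville_of_merges (G := ThompsonF)
    (X := MulAction.orbit ThompsonF unitHalf) fun E ε hε g => by
      obtain ⟨h, K, hE⟩ := ThompsonF.exists_pow_smul_eq E
      exact exists_merges_of_pow hE hε g
  refine ⟨μ, ?_, hsym, ?_, hL⟩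
  · rw [NonDegenerate, hsupp, Subgroup.closure_univ]
  · rw [hsupp]
    exact Set.infinite_univ
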